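/- Let $X$ and $Y$ be infinite-dimensional Banach spaces over the same scalar field, $\mathbb{R}$ or $\mathbb{C}$. Let $\mathcal{L}(X,Y)$ be the Banach space of bounded linear operators from $X$ to $Y$ with the operator norm, and let $K(X,Y)\subset\mathcal{L}(X,Y)$ be the subspace of compact operators. Say that a Banach space $F$ contains a Banach space $E$ isomorphically if $E$ is linearly homeomorphic to a closed linear subspace of $F$. Let $\ell^\infty$ be the space of bounded scalar sequences and $c_0$ the space of scalar sequences converging to $0$, both with the supremum norm. If $\mathcal{L}(X,Y)$ does not contain $\ell^\infty$ isomorphically, then $K(X,Y)$ does not contain $c_0$ isomorphically. -/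

import Mathlib

open scoped ENNReal ZeroAtInfty

/-- The normed space `F` contains `E` isomorphically: some linear subspace of `F`, with the norm of
`F`, is linearly homeomorphic to `E`. (If `E` is complete, such a subspace is closed in `F`.) -/
def ContainsIsomorphically (𝕜 : Type*) [RCLike 𝕜]
    (F : Type*) [NormedAddCommGroup F] [NormedSpace 𝕜 F]
    (E : Type*) [NormedAddCommGroup E] [NormedSpace 𝕜 E] : Prop :=
  ∃ S : Submodule 𝕜 F, Nonempty (E ≃L[𝕜] S)

/-- The space `ℓ^∞` of bounded scalar sequences with the supremum norm. -/
abbrev LInfty (𝕜 : Type*) [RCLike 𝕜] : Type _ := lp (fun _ : ℕ => 𝕜) ∞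

/-- The space `c₀` of scalar sequences tending to zero with the supremum norm: the continuous
functions vanishing at infinity on the discrete space `ℕ`. -/
abbrev CZero (𝕜 : Type*) [RCLike 𝕜] : Type _ := C₀(ℕ, 𝕜)

/-- The space `K(X, Y)` of compact bounded operators, a subspace of `X →L[𝕜] Y` with the operator
norm. -/
abbrev CompactOps (𝕜 : Type*) [RCLike 𝕜]
    (X : Type*) [NormedAddCommGroup X] [NormedSpace 𝕜 X]
    (Y : Type*) [NormedAddCommGroup Y] [NormedSpace 𝕜 Y] : Submodule 𝕜 (X →L[𝕜] Y) :=
  compactOperator (RingHom.id 𝕜) X Y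

/-! The unit vectors of a copy of c₀ in K(X, Y) give operators T_n, bounded below in norm, with ‖∑
a_i T_i‖ ≤ C sup |a_i| for finite sums (a weakly unconditionally Cauchy, or wuC, series). If ∑ ξ_n
T_n x converges for every bounded ξ and every x, then ξ ↦ ∑ ξ_n T_n is a bounded operator from ℓ^∞
to L(X, Y), bounded below on unit vectors, and by Rosenthal's theorem it is an isomorphism on the
sequences supported in some infinite set. If some such series diverges, suitable blocks z_n of it
are wuC in Y and bounded below. The Josefson–Nissenzweig theorem gives weak* null u_n in X*, bounded
below, and the rank-one operators u_n ⊗ z_n fall under the first case because ξ_n u_n(x) → 0.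

For Josefson–Nissenzweig, take a bounded separated sequence in X*. By Ramsey theory it has either a
weak* convergent subsequence, whose differences suffice, or an ℓ¹-subsequence. In the latter case,
either successive block sequences become small at every point and a diagonal sequence works, or
oscillation persists and Haar averaging gives functionals with ∑ u_j(x)² ≤ ‖x‖². -/

open Filter Topology

/-! ### Ramsey theory through ultrafilter trees -/

/-- Given sets `G t` in a nonprincipal ultrafilter, indexed by finite sequences `t`, there is an
increasing sequence all of whose subsequences are branches of the tree described by `G`. -/
theorem exists_strictMono_forall_subseq_mem {U : Ultrafilter ℕ} (hU : (U : Filter ℕ) ≤ atTop)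
    (G : List ℕ → Set ℕ) (hG : ∀ t, G t ∈ U) :
    ∃ n : ℕ → ℕ, StrictMono n ∧ ∀ φ : ℕ → ℕ, StrictMono φ → ∀ k,
      n (φ k) ∈ G ((List.range k).map (n ∘ φ)) := by
  -- Only finitely many subsequences of the earlier terms exist, so one new term can serve all of
  -- them at once.
  have hex : ∀ L : List ℕ, ∃ a, (∀ t ∈ L.sublists, a ∈ G t) ∧ ∀ b ∈ L, b < a := by
    intro L
    have h1 : ∀ᶠ a in (U : Filter ℕ), ∀ t ∈ {t | t ∈ L.sublists}, a ∈ G t :=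
      (eventually_all_finite (List.finite_toSet _)).2 fun t _ => hG t
    have h2 : ∀ᶠ a in (U : Filter ℕ), ∀ b ∈ {b | b ∈ L}, b < a :=
      (eventually_all_finite (List.finite_toSet _)).2 fun b _ => hU (eventually_gt_atTop b)
    exact (h1.and h2).exists
  choose c hc1 hc2 using hex
  let P : ℕ → List ℕ := fun k => Nat.rec [] (fun _ L => L ++ [c L]) k
  have hP : ∀ k, P (k + 1) = P k ++ [c (P k)] := fun k => rfl
  have hmono : ∀ i j, i ≤ j → (P i).Sublist (P j) := by
    intro i j hij
    induction j, hij using Nat.le_induction with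
    | base => exact List.Sublist.refl _
    | succ j _ ih => rw [hP]; exact ih.trans (List.sublist_append_left _ _)
  refine ⟨fun k => c (P k), strictMono_nat_of_lt_succ fun k => ?_, fun φ hφ k => ?_⟩
  · exact hc2 _ _ (by rw [hP]; simp)
  · refine hc1 _ _ (List.mem_sublists.2 ?_)
    induction k with
    | zero => simp
    | succ k ih =>
      rw [List.range_succ, List.map_append]
      refine List.Sublist.trans ?_ (hmono _ _ (hφ (Nat.lt_succ_self k)))
      rw [hP]
      exact ih.append (List.Sublist.refl _)

/-- Open sets are Ramsey: either some infinite set has all its infinite subsets with an initial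
segment in `F`, or some infinite set has no finite initial segments of subsets in `F`. -/
theorem exists_strictMono_ramsey (F : List ℕ → Prop) :
    (∃ n : ℕ → ℕ, StrictMono n ∧ ∀ φ : ℕ → ℕ, StrictMono φ →
      ∃ k, F ((List.range k).map (n ∘ φ))) ∨
    (∃ n : ℕ → ℕ, StrictMono n ∧ ∀ φ : ℕ → ℕ, StrictMono φ →
      ∀ k, ¬ F ((List.range k).map (n ∘ φ))) := by
  let U : Ultrafilter ℕ := hyperfilter ℕ
  have hU : (U : Filter ℕ) ≤ atTop := Nat.hyperfilter_le_atTop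
  -- `Q s`: some tree over `s` with `U`-large branching forces every branch into `F`. If `Q s`
  -- fails, then `U`-almost every one-term extension fails too, so failure at the root can be
  -- preserved forever.
  let Q : List ℕ → Prop := fun s => ∃ G : List ℕ → Set ℕ, (∀ t, G t ∈ U) ∧
    ∀ m : ℕ → ℕ, (∀ k, m k ∈ G ((List.range k).map m)) → ∃ k, F (s ++ (List.range k).map m)
  have hQF : ∀ s, F s → Q s := fun s hs =>
    ⟨fun _ => Set.univ, fun _ => univ_mem, fun m _ => ⟨0, by simpa using hs⟩⟩
  have hQ : ∀ s, {a | Q (s ++ [a])} ∈ U → Q s := by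
    intro s hs
    choose! G hG1 hG2 using fun a (ha : a ∈ {a | Q (s ++ [a])}) => ha
    classical
    -- The trees above the good one-term extensions are glued under one root.
    refine ⟨fun t => match t with
      | [] => {a | Q (s ++ [a])}
      | a :: t => if Q (s ++ [a]) then G a t else Set.univ, ?_, ?_⟩
    · rintro (_ | ⟨a, t⟩)
      · exact hs
      · dsimp only
        split_ifs with h
        · exact hG1 a h t
        · exact univ_mem
    · intro m hm
      have h0 : Q (s ++ [m 0]) := hm 0
      obtain ⟨k, hk⟩ := hG2 (m 0) h0 (fun k => m (k + 1)) (fun k => by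
        have := hm (k + 1)
        rw [List.range_succ_eq_map] at this
        simpa [h0, Function.comp_def] using this)
      refine ⟨k + 1, ?_⟩
      rw [List.range_succ_eq_map]
      simpa [Function.comp_def] using hk
  by_cases h : Q []
  · left
    obtain ⟨G, hG1, hG2⟩ := h
    obtain ⟨n, hn, hn2⟩ := exists_strictMono_forall_subseq_mem hU G hG1
    exact ⟨n, hn, fun φ hφ => by simpa using hG2 (n ∘ φ) (hn2 φ hφ)⟩
  · right
    obtain ⟨n, hn, hn2⟩ := exists_strictMono_forall_subseq_mem hU
      (fun t => {a | ¬ Q t → ¬ Q (t ++ [a])}) (fun t => by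
        by_cases ht : Q t
        · exact mem_of_superset univ_mem fun _ _ h => absurd ht h
        · have : {a | Q (t ++ [a])} ∉ U := fun h => ht (hQ t h)
          exact mem_of_superset (Ultrafilter.compl_mem_iff_notMem.2 this) fun _ h _ => h)
    refine ⟨n, hn, fun φ hφ k hF => ?_⟩
    have : ¬ Q ((List.range k).map (n ∘ φ)) := by
      clear hF
      induction k with
      | zero => simpa using h
      | succ k ih =>
        rw [List.range_succ, List.map_append]
        exact hn2 φ hφ k ih
    exact this (hQF _ hF)

/-! ### Independence and Rosenthal's dichotomy -/

/-- If every subsequence of the pairs `(A n, B n)` has a point which lies infinitely often in both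
members, then some subsequence is Boolean independent. -/
theorem exists_strictMono_independent {S : Type*} (A B : ℕ → Set S)
    (h : ∀ φ : ℕ → ℕ, StrictMono φ →
      ∃ x, (∃ᶠ k in atTop, x ∈ A (φ k)) ∧ ∃ᶠ k in atTop, x ∈ B (φ k)) :
    ∃ n : ℕ → ℕ, StrictMono n ∧ ∀ (ε : ℕ → Prop) (k : ℕ),
      ∃ x, ∀ i < k, (ε i → x ∈ A (n i)) ∧ (¬ ε i → x ∈ B (n i)) := by
  classical
  -- `F` holds of the finite sequences along which no point lies alternately in `A` and `B`.
  rcases exists_strictMono_ramsey (fun s : List ℕ => ¬ ∃ x, ∀ i a : ℕ, s[i]? = some a →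
    (Even i → x ∈ A a) ∧ (¬ Even i → x ∈ B a)) with ⟨n, hn, H⟩ | ⟨n, hn, H⟩
  · exfalso
    obtain ⟨x, hA, hB⟩ := h n hn
    obtain ⟨φ, hφ, hx⟩ := extraction_forall_of_frequently
      (P := fun i k => (Even i → x ∈ A (n k)) ∧ (¬ Even i → x ∈ B (n k))) (fun i => by
        by_cases hi : Even i
        · simpa [hi] using hA
        · simpa [hi] using hB)
    obtain ⟨k, hk⟩ := H φ hφ
    refine hk ⟨x, fun i a hia => ?_⟩
    rw [List.getElem?_map, Option.map_eq_some_iff] at hia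
    obtain ⟨j, hj, rfl⟩ := hia
    obtain ⟨hlt, rfl⟩ := List.getElem?_eq_some_iff.1 hj
    simpa using hx i
  -- The index 3i+1 is put at the even position 2i (forcing `A`) or at the odd position 2i+1
  -- (forcing `B`) according to `ε i`; a filler, 3i+2 or 3i, takes the other position.
  · refine ⟨fun i => n (3 * i + 1), fun i j hij => hn (by omega), fun ε k => ?_⟩
    let φ : ℕ → ℕ := fun j => 3 * (j / 2) + j % 2 + (if ε (j / 2) then 1 else 0)
    have hφ : StrictMono φ := by
      refine strictMono_nat_of_lt_succ fun j => ?_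
      dsimp only [φ]
      rcases Nat.mod_two_eq_zero_or_one j with hj | hj
      · have h1 : (j + 1) / 2 = j / 2 := by omega
        rw [h1]; omega
      · split_ifs <;> omega
    obtain ⟨x, hx⟩ := not_not.1 (H φ hφ (2 * k))
    refine ⟨x, fun i hi => ⟨fun hε => ?_, fun hε => ?_⟩⟩
    · have h2 : 2 * i < 2 * k := by omega
      have := (hx (2 * i) (n (φ (2 * i))) (by simp [h2])).1 (by simp)
      have h3 : φ (2 * i) = 3 * i + 1 := by simp [φ, hε]
      rwa [h3] at this
    · have h2 : 2 * i + 1 < 2 * k := by omega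
      have := (hx (2 * i + 1) (n (φ (2 * i + 1))) (by simp [h2])).2 (by simp)
      have h3 : φ (2 * i + 1) = 3 * i + 1 := by
        have : (2 * i + 1) / 2 = i := by omega
        simp only [φ, this, hε, if_false]; omega
      rwa [h3] at this

/-- A uniformly bounded sequence of real functions has a pointwise convergent subsequence, or a
subsequence which is Boolean independent across a gap `(r, s)`. -/
theorem exists_pointwise_tendsto_or_independent {S : Type*} (f : ℕ → S → ℝ) (C : ℝ)
    (hC : ∀ n x, |f n x| ≤ C) :
    (∃ φ : ℕ → ℕ, StrictMono φ ∧ ∀ x, ∃ l, Tendsto (fun k => f (φ k) x) atTop (𝓝 l)) ∨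
    ∃ r s : ℝ, r < s ∧ ∃ φ : ℕ → ℕ, StrictMono φ ∧ ∀ (ε : ℕ → Prop) (k : ℕ),
      ∃ x, ∀ i < k, (ε i → s < f (φ i) x) ∧ (¬ ε i → f (φ i) x < r) := by
  by_contra! hcon
  obtain ⟨hconv, hind⟩ := hcon
  -- Any infinite index set can be thinned until no point oscillates across a given rational gap;
  -- otherwise every subsequence has an oscillating point and independence follows.
  have step : ∀ (p : ℚ × ℚ) (M : {M : Set ℕ // ∃ᶠ m in atTop, m ∈ M}),
      ∃ M' : {M : Set ℕ // ∃ᶠ m in atTop, m ∈ M}, M'.1 ⊆ M.1 ∧ (p.1 < p.2 → ∀ x,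
        ¬ ((∃ᶠ m in atTop, m ∈ M'.1 ∧ f m x < p.1) ∧
          ∃ᶠ m in atTop, m ∈ M'.1 ∧ (p.2 : ℝ) < f m x)) := by
    rintro ⟨r, s⟩ ⟨M, hM⟩
    by_cases hrs : r < s
    swap
    · exact ⟨⟨M, hM⟩, subset_rfl, fun h => absurd h hrs⟩
    by_contra! hno
    obtain ⟨ψ, hψ, hψM⟩ := extraction_of_frequently_atTop hM
    obtain ⟨n, hn, hnn⟩ := exists_strictMono_independent
      (fun n => {x | (s : ℝ) < f (ψ n) x}) (fun n => {x | f (ψ n) x < r}) (by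
        intro φ hφ
        have hinf : ∃ᶠ m in atTop, m ∈ Set.range (ψ ∘ φ) :=
          (hψ.comp hφ).tendsto_atTop.frequently (Frequently.of_forall fun k => ⟨k, rfl⟩)
        obtain ⟨-, x, hx1, hx2⟩ := hno ⟨_, hinf⟩ (by rintro _ ⟨k, rfl⟩; exact hψM _)
        have key : ∀ p : ℕ → Prop, (∃ᶠ m in atTop, m ∈ Set.range (ψ ∘ φ) ∧ p m) →
            ∃ᶠ k in atTop, p (ψ (φ k)) := by
          intro p hp
          rw [frequently_atTop] at hp ⊢
          intro a
          obtain ⟨b, hb, ⟨k, rfl⟩, hk⟩ := hp (ψ (φ a))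
          exact ⟨k, (hψ.comp hφ).le_iff_le.1 hb, hk⟩
        exact ⟨x, key _ hx2, key _ hx1⟩)
    obtain ⟨ε, k, hk⟩ := hind r s (by exact_mod_cast hrs) (ψ ∘ n) (hψ.comp hn)
    obtain ⟨x, hx⟩ := hnn ε k
    obtain ⟨i, hi, h⟩ := hk x
    by_cases hε : ε i
    · have := (hx i hi).1 hε
      have h3 := h fun _ => this
      exact h3.1 hε
    · have := (hx i hi).2 hε
      exact absurd this (not_lt.2 (h fun h' => absurd h' hε).2)
  choose g hg1 hg2 using step
  obtain ⟨p, hp⟩ := exists_surjective_nat (ℚ × ℚ)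
  let M : ℕ → {M : Set ℕ // ∃ᶠ m in atTop, m ∈ M} := fun k =>
    Nat.rec ⟨Set.univ, Frequently.of_forall fun _ => trivial⟩ (fun k N => g (p k) N) k
  have hanti : Antitone fun k => (M k).1 := antitone_nat_of_succ_le fun k => hg1 (p k) (M k)
  -- The diagonal sequence is eventually in each `M k`, so no point oscillates across any rational
  -- gap along it.
  obtain ⟨d, hd, hdM⟩ := extraction_forall_of_frequently (P := fun k m => m ∈ (M k).1)
    fun k => (M k).2
  obtain ⟨x, hx⟩ := hconv d hd
  obtain ⟨l, hl⟩ := tendsto_of_no_upcrossings (f := atTop) (u := fun k => f (d k) x)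
    (Rat.denseRange_cast (𝕜 := ℝ)) (by
      rintro _ ⟨r, rfl⟩ _ ⟨s, rfl⟩ hrs ⟨h1, h2⟩
      obtain ⟨k, hk⟩ := hp (r, s)
      have key : ∀ q : ℕ → Prop, (∃ᶠ n in atTop, q (d n)) →
          ∃ᶠ m in atTop, m ∈ (M (k + 1)).1 ∧ q m := by
        intro q hq
        refine hd.tendsto_atTop.frequently ((hq.and_eventually (eventually_ge_atTop (k + 1))).mono ?_)
        rintro n ⟨hn, hkn⟩
        exact ⟨hanti hkn (hdM n), hn⟩
      refine hg2 (p k) (M k) (by rw [hk]; exact_mod_cast hrs) x ⟨?_, ?_⟩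
      · rw [hk]; have := key (fun m => f m x < r) h1
        simpa only [M, hk] using this
      · rw [hk]; have := key (fun m => (s : ℝ) < f m x) h2
        simpa only [M, hk] using this)
    (isBoundedUnder_of ⟨C, fun k => (abs_le.1 (hC _ x)).2⟩)
    (isBoundedUnder_of ⟨-C, fun k => (abs_le.1 (hC _ x)).1⟩)
  exact hx l hl

/-- Dependent choice, in the form needed for both the Haar averaging and the diagonal block
construction. -/
theorem exists_seq_of_step {α : Type*} (P : ℕ → α → Prop) (R : ℕ → α → α → Prop) (a : α)
    (ha : P 0 a) (h : ∀ k a, P k a → ∃ b, P (k + 1) b ∧ R k a b) :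
    ∃ s : ℕ → α, s 0 = a ∧ ∀ k, P k (s k) ∧ R k (s k) (s (k + 1)) := by
  choose! g hg1 hg2 using h
  let s : ℕ → α := fun k => Nat.rec a (fun k b => g k b) k
  have hs : ∀ k, P k (s k) := by
    intro k
    induction k with
    | zero => exact ha
    | succ k ih => exact hg1 k _ ih
  exact ⟨s, rfl, fun k => ⟨hs k, hg2 k _ (hs k)⟩⟩

/-! ### Block sequences in ℓ¹ -/

/-- The `ℓ¹`-norm of a finitely supported sequence. -/
noncomputable def absSum (w : ℕ →₀ ℝ) : ℝ := w.sum fun _ a => |a|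

theorem absSum_eq_sum {w : ℕ →₀ ℝ} {s : Finset ℕ} (h : w.support ⊆ s) :
    absSum w = ∑ i ∈ s, |w i| :=
  Finsupp.sum_of_support_subset _ h _ (by simp)

theorem absSum_smul (c : ℝ) (w : ℕ →₀ ℝ) : absSum (c • w) = |c| * absSum w := by
  rw [absSum_eq_sum (s := w.support) Finsupp.support_smul, absSum_eq_sum subset_rfl,
    Finset.mul_sum]
  simp [abs_mul]

theorem absSum_neg (w : ℕ →₀ ℝ) : absSum (-w) = absSum w := by
  simpa using absSum_smul (-1) w

theorem absSum_single (i : ℕ) (a : ℝ) : absSum (Finsupp.single i a) = |a| := by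
  simp [absSum]

theorem absSum_add_of_disjoint {u v : ℕ →₀ ℝ} (h : Disjoint u.support v.support) :
    absSum (u + v) = absSum u + absSum v :=
  Finsupp.sum_add_index_of_disjoint h _

theorem absSum_sum_of_disjoint (g : ℕ → ℕ →₀ ℝ) (s : Finset ℕ)
    (h : Pairwise fun i j => Disjoint (g i).support (g j).support) :
    absSum (∑ i ∈ s, g i) = ∑ i ∈ s, absSum (g i) := by
  classical
  induction s using Finset.induction_on with
  | empty => simp [absSum]
  | insert a s ha ih =>
    rw [Finset.sum_insert ha, Finset.sum_insert ha, absSum_add_of_disjoint, ih]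
    refine Disjoint.mono_right (Finsupp.support_finsetSum (s := s) (f := g)) ?_
    rw [Finset.disjoint_biUnion_right]
    intro i hi
    exact h (by rintro rfl; exact ha hi)

/-- Sequences of disjointly supported vectors of `ℓ¹`-norm one. -/
structure IsBlockSeq (w : ℕ → ℕ →₀ ℝ) : Prop where
  absSum_eq : ∀ k, absSum (w k) = 1
  disjoint : Pairwise fun i j => Disjoint (w i).support (w j).support

/-- `h` is built from tails of `g`. -/
def IsTailSpan (h g : ℕ → ℕ →₀ ℝ) : Prop :=
  ∀ k, h k ∈ Submodule.span ℝ (g '' Set.Ici k)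

theorem IsTailSpan.refl (g : ℕ → ℕ →₀ ℝ) : IsTailSpan g g := fun k =>
  Submodule.subset_span ⟨k, Set.self_mem_Ici, rfl⟩

theorem IsTailSpan.mem {h g : ℕ → ℕ →₀ ℝ} (H : IsTailSpan h g) {k n : ℕ} (hkn : k ≤ n) :
    h n ∈ Submodule.span ℝ (g '' Set.Ici k) :=
  Submodule.span_mono (Set.image_mono (Set.Ici_subset_Ici.2 hkn)) (H n)

theorem IsTailSpan.trans {h g w : ℕ → ℕ →₀ ℝ} (H : IsTailSpan h g) (H' : IsTailSpan g w) :
    IsTailSpan h w := by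
  intro k
  refine Submodule.span_le.2 ?_ (H k)
  rintro _ ⟨n, hn, rfl⟩
  exact H'.mem hn

/-- Disjoint supports make the ℓ¹-norm of a combination of blocks the sum of its absolute
coefficients. Smallness at a point thus passes to all later blocks. -/
theorem IsBlockSeq.abs_le_of_mem_span {w : ℕ → ℕ →₀ ℝ} (hw : IsBlockSeq w)
    (L : (ℕ →₀ ℝ) →ₗ[ℝ] ℝ) {k : ℕ} {M : ℝ} (hM : ∀ i, k ≤ i → |L (w i)| ≤ M) {v : ℕ →₀ ℝ}
    (hv : v ∈ Submodule.span ℝ (w '' Set.Ici k)) : |L v| ≤ M * absSum v := by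
  obtain ⟨l, hl, rfl⟩ := (Finsupp.mem_span_image_iff_linearCombination ℝ).1 hv
  rw [Finsupp.linearCombination_apply, Finsupp.sum, absSum_sum_of_disjoint, map_sum,
    Finset.mul_sum]
  · refine (Finset.abs_sum_le_sum_abs _ _).trans (Finset.sum_le_sum fun i hi => ?_)
    rw [absSum_smul, hw.absSum_eq, mul_one, map_smul, smul_eq_mul, abs_mul, mul_comm]
    exact mul_le_mul_of_nonneg_right (hM i ((Finsupp.mem_supported _ _).1 hl hi)) (abs_nonneg _)
  · intro i j hij
    exact (hw.disjoint hij).mono Finsupp.support_smul Finsupp.support_smul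

theorem IsBlockSeq.comp {w : ℕ → ℕ →₀ ℝ} (hw : IsBlockSeq w) {φ : ℕ → ℕ} (hφ : StrictMono φ) :
    IsBlockSeq (w ∘ φ) :=
  ⟨fun _ => hw.absSum_eq _, fun _ _ hij => hw.disjoint (hφ.injective.ne hij)⟩

/-- By disjointness of supports, the factor 1/2 restores ℓ¹-norm one. Half-sums form the next Haar
generation and half-differences supply the new functionals. -/
theorem IsBlockSeq.half_add {w : ℕ → ℕ →₀ ℝ} (hw : IsBlockSeq w) :
    IsBlockSeq fun n => (1 / 2 : ℝ) • (w (2 * n) + w (2 * n + 1)) := by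
  classical
  refine ⟨fun k => ?_, fun i j hij => ?_⟩
  · rw [absSum_smul, absSum_add_of_disjoint (hw.disjoint (by omega)), hw.absSum_eq, hw.absSum_eq]
    norm_num
  · refine Disjoint.mono (Finsupp.support_smul.trans Finsupp.support_add)
      (Finsupp.support_smul.trans Finsupp.support_add) ?_
    simp only [Finset.disjoint_union_left, Finset.disjoint_union_right]
    exact ⟨⟨hw.disjoint (by omega), hw.disjoint (by omega)⟩, hw.disjoint (by omega),
      hw.disjoint (by omega)⟩

theorem IsBlockSeq.half_sub {w : ℕ → ℕ →₀ ℝ} (hw : IsBlockSeq w) :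
    IsBlockSeq fun n => (1 / 2 : ℝ) • (w (2 * n) - w (2 * n + 1)) := by
  classical
  refine ⟨fun k => ?_, fun i j hij => ?_⟩
  · rw [absSum_smul, sub_eq_add_neg, absSum_add_of_disjoint, absSum_neg, hw.absSum_eq,
      hw.absSum_eq]
    · norm_num
    · rw [Finsupp.support_neg]; exact hw.disjoint (by omega)
  · refine Disjoint.mono (Finsupp.support_smul.trans Finsupp.support_sub)
      (Finsupp.support_smul.trans Finsupp.support_sub) ?_
    simp only [Finset.disjoint_union_left, Finset.disjoint_union_right]
    exact ⟨⟨hw.disjoint (by omega), hw.disjoint (by omega)⟩, hw.disjoint (by omega),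
      hw.disjoint (by omega)⟩

theorem IsTailSpan.half_add {w g : ℕ → ℕ →₀ ℝ} (hw : IsTailSpan w g) :
    IsTailSpan (fun n => (1 / 2 : ℝ) • (w (2 * n) + w (2 * n + 1))) g := fun n =>
  Submodule.smul_mem _ _ (Submodule.add_mem _ (hw.mem (by omega)) (hw.mem (by omega)))

theorem IsTailSpan.half_sub {w g : ℕ → ℕ →₀ ℝ} (hw : IsTailSpan w g) :
    IsTailSpan (fun n => (1 / 2 : ℝ) • (w (2 * n) - w (2 * n + 1))) g := fun n =>
  Submodule.smul_mem _ _ (Submodule.sub_mem _ (hw.mem (by omega)) (hw.mem (by omega)))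

theorem IsTailSpan.comp {w g : ℕ → ℕ →₀ ℝ} (hw : IsTailSpan w g) {φ : ℕ → ℕ}
    (hφ : StrictMono φ) : IsTailSpan (w ∘ φ) g := fun n => hw.mem (hφ.id_le n)

/-! ### The Josefson–Nissenzweig theorem -/

section Dual

variable {X : Type*} [NormedAddCommGroup X] [NormedSpace ℝ X]

theorem norm_linearCombination_le_absSum (f : ℕ → StrongDual ℝ X) {C : ℝ} (hf : ∀ n, ‖f n‖ ≤ C)
    (w : ℕ →₀ ℝ) : ‖Finsupp.linearCombination ℝ f w‖ ≤ C * absSum w := by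
  rw [Finsupp.linearCombination_apply, absSum, Finsupp.sum, Finsupp.sum, Finset.mul_sum]
  refine (norm_sum_le _ _).trans (Finset.sum_le_sum fun i _ => ?_)
  rw [norm_smul, Real.norm_eq_abs, mul_comm]
  exact mul_le_mul_of_nonneg_right (hf i) (abs_nonneg _)

/-- A sequence of functionals which is Boolean independent on the unit ball dominates the
`ℓ¹`-norm. -/
theorem absSum_le_norm_of_independent (f : ℕ → StrongDual ℝ X) {r s : ℝ}
    (h : ∀ (ε : ℕ → Prop) (k : ℕ), ∃ x : X, ‖x‖ ≤ 1 ∧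
      ∀ i < k, (ε i → s < f i x) ∧ (¬ ε i → f i x < r)) (w : ℕ →₀ ℝ) :
    (s - r) / 2 * absSum w ≤ ‖Finsupp.linearCombination ℝ f w‖ := by
  obtain ⟨k, hk⟩ : ∃ k, w.support ⊆ Finset.range k :=
    ⟨w.support.sup id + 1, fun i hi => by
      have := Finset.le_sup (f := id) hi
      simp only [id] at this
      simp only [Finset.mem_range]; omega⟩
  -- Two points with opposite sign patterns are compared, since 0 need not lie in the gap; this
  -- costs the factor 1/2.
  obtain ⟨x, hx1, hx⟩ := h (fun i => 0 ≤ w i) k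
  obtain ⟨y, hy1, hy⟩ := h (fun i => ¬ 0 ≤ w i) k
  set g := Finsupp.linearCombination ℝ f w with hg
  have hev : ∀ z : X, g z = ∑ i ∈ Finset.range k, w i * f i z := by
    intro z
    rw [hg, Finsupp.linearCombination_apply, Finsupp.sum_of_support_subset _ hk _ (by simp)]
    simp
  have hlow : (s - r) * absSum w ≤ g x - g y := by
    rw [hev, hev, absSum_eq_sum hk, Finset.mul_sum, ← Finset.sum_sub_distrib]
    refine Finset.sum_le_sum fun i hi => ?_
    have hi' := Finset.mem_range.1 hi
    by_cases hw : 0 ≤ w i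
    · have h1 := (hx i hi').1 hw
      have h2 := (hy i hi').2 (not_not.2 hw)
      rw [abs_of_nonneg hw]
      nlinarith
    · have h1 := (hx i hi').2 hw
      have h2 := (hy i hi').1 hw
      rw [abs_of_neg (not_le.1 hw)]
      nlinarith
  have h3 : ∀ z : X, ‖z‖ ≤ 1 → |g z| ≤ ‖g‖ := fun z hz => by
    have := g.le_opNorm z
    rw [Real.norm_eq_abs] at this
    nlinarith [norm_nonneg g]
  have h4 := abs_le.1 (h3 x hx1)
  have h5 := abs_le.1 (h3 y hy1)
  linarith

/-- If every block sequence of `g` oscillates by a fixed amount on the unit ball, then iterated Haar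
averaging and a limit along an ultrafilter produce functionals, bounded below in norm, whose values
at each point are square summable. -/
theorem exists_square_summable_functionals (f : ℕ → StrongDual ℝ X) (hf : ∀ n, ‖f n‖ ≤ 1)
    {g : ℕ → ℕ →₀ ℝ} (hg : IsBlockSeq g) {δ : ℝ}
    (H : ∀ h, IsBlockSeq h → IsTailSpan h g →
      ∃ x : X, ‖x‖ ≤ 1 ∧ ∃ᶠ n in atTop, δ < |Finsupp.linearCombination ℝ f (h n) x|) :
    ∃ u : ℕ → StrongDual ℝ X, (∀ j, ∃ x, ‖x‖ ≤ 1 ∧ δ ≤ u j x) ∧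
      ∀ x N, ∑ j ∈ Finset.range N, (u j x) ^ 2 ≤ ‖x‖ ^ 2 := by
  classical
  set J := Finsupp.linearCombination ℝ f with hJ
  -- State after `k` averagings: blocks `a.1 n`, each with `k` functionals obeying a joint square
  -- bound. `R` demands one-sided lower bounds at fixed points, which survive later averaging,
  -- whereas bounds on absolute values might not.
  let P : ℕ → (ℕ → ℕ →₀ ℝ) × (ℕ → ℕ → StrongDual ℝ X) → Prop := fun k a =>
    IsBlockSeq a.1 ∧ IsTailSpan a.1 g ∧
      ∀ n x, (J (a.1 n) x) ^ 2 + ∑ j ∈ Finset.range k, (a.2 n j x) ^ 2 ≤ ‖x‖ ^ 2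
  let R : ℕ → (ℕ → ℕ →₀ ℝ) × (ℕ → ℕ → StrongDual ℝ X) →
      (ℕ → ℕ →₀ ℝ) × (ℕ → ℕ → StrongDual ℝ X) → Prop := fun k a b =>
    (∃ x : X, ‖x‖ ≤ 1 ∧ ∀ n, δ ≤ b.2 n k x) ∧
      ∀ j < k, ∀ y, (∀ n, δ ≤ a.2 n j y) → ∀ n, δ ≤ b.2 n j y
  have hP0 : P 0 (g, fun _ _ => 0) := by
    refine ⟨hg, IsTailSpan.refl g, fun n x => ?_⟩
    have h1 : ‖J (g n)‖ ≤ 1 := by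
      simpa [hg.absSum_eq] using norm_linearCombination_le_absSum f hf (g n)
    have h2 := (J (g n)).le_of_opNorm_le h1 x
    rw [one_mul, Real.norm_eq_abs] at h2
    simpa using sq_le_sq' (by linarith [(abs_le.1 h2).1]) (abs_le.1 h2).2
  obtain ⟨s, -, hs⟩ := exists_seq_of_step P R _ hP0 (by
    rintro k ⟨φ, p⟩ ⟨h1, h2, h3⟩
    obtain ⟨x, hx, hfreq⟩ : ∃ x : X, ‖x‖ ≤ 1 ∧ ∃ᶠ n in atTop,
        δ < J ((1 / 2 : ℝ) • (φ (2 * n) - φ (2 * n + 1))) x := by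
      obtain ⟨x, hx, hfreq⟩ := H _ h1.half_sub h2.half_sub
      simp only [lt_abs, frequently_or_distrib] at hfreq
      rcases hfreq with hfreq | hfreq
      · exact ⟨x, hx, hfreq⟩
      · exact ⟨-x, by rwa [norm_neg], by simpa only [map_neg] using hfreq⟩
    obtain ⟨θ, hθ, hθx⟩ := extraction_of_frequently_atTop hfreq
    refine ⟨((fun n => (1 / 2 : ℝ) • (φ (2 * n) + φ (2 * n + 1))) ∘ θ, fun n j =>
      if j = k then J ((1 / 2 : ℝ) • (φ (2 * θ n) - φ (2 * θ n + 1)))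
      else (1 / 2 : ℝ) • (p (2 * θ n) j + p (2 * θ n + 1) j)),
      ⟨h1.half_add.comp hθ, h2.half_add.comp hθ, fun n y => ?_⟩, ⟨x, hx, fun n => ?_⟩, ?_⟩
    -- The identity ((a+b)/2)² + ((a−b)/2)² = (a²+b²)/2 handles the block and the new functional;
    -- convexity of the square handles the old ones.
    · have ha := h3 (2 * θ n) y
      have hb := h3 (2 * θ n + 1) y
      have hsum : ∑ j ∈ Finset.range k, ((if j = k then
          J ((1 / 2 : ℝ) • (φ (2 * θ n) - φ (2 * θ n + 1)))
          else (1 / 2 : ℝ) • (p (2 * θ n) j + p (2 * θ n + 1) j)) y) ^ 2 ≤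
          1 / 2 * (∑ j ∈ Finset.range k, (p (2 * θ n) j y) ^ 2 +
            ∑ j ∈ Finset.range k, (p (2 * θ n + 1) j y) ^ 2) := by
        rw [← Finset.sum_add_distrib, Finset.mul_sum]
        refine Finset.sum_le_sum fun j hj => ?_
        rw [if_neg (Finset.mem_range.1 hj).ne]
        simp only [smul_apply, add_apply, smul_eq_mul]
        nlinarith [sq_nonneg (p (2 * θ n) j y - p (2 * θ n + 1) j y)]
      rw [Finset.sum_range_succ]
      simp only [Function.comp_apply, if_true, map_smul, map_add, map_sub,
        smul_apply, add_apply,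
        sub_apply, smul_eq_mul] at hsum ⊢
      nlinarith
    · simpa using (hθx n).le
    · intro j hj y hy n
      have ha := hy (2 * θ n)
      have hb := hy (2 * θ n + 1)
      simp only [if_neg hj.ne, smul_apply, add_apply,
        smul_eq_mul] at ha hb ⊢
      linarith)
  choose x hx hxδ using fun k => (hs k).2.1
  have hlow : ∀ j k, j < k → ∀ n, δ ≤ (s k).2 n j (x j) := by
    intro j k hjk
    induction k, hjk using Nat.le_induction with
    | base => exact hxδ j
    | succ k hk ih => exact (hs k).2.2 j hk _ ih
  let q : ℕ → ℕ → StrongDual ℝ X := fun k => (s k).2 0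
  have hq : ∀ k y, ∑ j ∈ Finset.range k, (q k j y) ^ 2 ≤ ‖y‖ ^ 2 := fun k y => by
    have := (hs k).1.2.2 0 y
    nlinarith [sq_nonneg (J ((s k).1 0) y)]
  have hq1 : ∀ j k, j < k → ‖q k j‖ ≤ 1 := fun j k hjk => by
    refine ContinuousLinearMap.opNorm_le_bound _ zero_le_one fun y => ?_
    rw [one_mul, Real.norm_eq_abs]
    refine abs_le_of_sq_le_sq ?_ (norm_nonneg y)
    exact (Finset.single_le_sum (f := fun j => (q k j y) ^ 2) (fun _ _ => sq_nonneg _)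
      (Finset.mem_range.2 hjk)).trans (hq k y)
  let U : Ultrafilter ℕ := hyperfilter ℕ
  have hU : (U : Filter ℕ) ≤ atTop := Nat.hyperfilter_le_atTop
  -- Banach–Alaoglu gives weak* limits along `U`; the lower bounds and the finite square sums pass
  -- to the limit.
  have hlim : ∀ j, ∃ u : StrongDual ℝ X, ∀ y, Tendsto (fun k => q k j y) U (𝓝 (u y)) := by
    intro j
    obtain ⟨u, -, hu⟩ := (WeakDual.isCompact_closedBall (0 : StrongDual ℝ X)
      1).ultrafilter_le_nhds (U.map fun k => StrongDual.toWeakDual (q k j)) (by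
        have : ∀ᶠ k in (U : Filter ℕ), StrongDual.toWeakDual (q k j) ∈
            WeakDual.toStrongDual ⁻¹' Metric.closedBall (0 : StrongDual ℝ X) 1 :=
          Eventually.mono (hU (eventually_gt_atTop j)) fun k hk => by simpa using hq1 j k hk
        exact le_principal_iff.2 this)
    refine ⟨WeakDual.toStrongDual u, fun y => ?_⟩
    have h1 : Tendsto (fun k => StrongDual.toWeakDual (q k j)) U (𝓝 u) := hu
    exact ((WeakDual.eval_continuous y).tendsto u).comp h1
  choose u hu using hlim
  refine ⟨u, fun j => ⟨x j, hx j, ge_of_tendsto (hu j (x j)) ?_⟩, fun y N => ?_⟩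
  · exact Eventually.mono (hU (eventually_gt_atTop j)) fun k hk => hlow j k hk 0
  · refine le_of_tendsto (tendsto_finsetSum _ fun j _ => (hu j y).pow 2) ?_
    refine Eventually.mono (hU (eventually_ge_atTop N)) fun k hk => (Finset.sum_le_sum_of_subset_of_nonneg
      (Finset.range_mono hk) fun _ _ _ => sq_nonneg _).trans (hq k y)

/-- If an `ℓ¹`-sequence lies in the dual space, then the dual space contains a weak* null sequence
which is bounded below in norm. -/
theorem exists_weakStar_null_of_absSum_le (f : ℕ → StrongDual ℝ X) (hf : ∀ n, ‖f n‖ ≤ 1) {c : ℝ}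
    (hc : 0 < c) (hfc : ∀ w, c * absSum w ≤ ‖Finsupp.linearCombination ℝ f w‖) :
    ∃ (u : ℕ → StrongDual ℝ X) (c : ℝ), 0 < c ∧ (∀ n, c ≤ ‖u n‖) ∧
      ∀ x, Tendsto (fun n => u n x) atTop (𝓝 0) := by
  set J := Finsupp.linearCombination ℝ f with hJ
  by_cases H : ∃ g, IsBlockSeq g ∧ ∃ δ > 0, ∀ h, IsBlockSeq h → IsTailSpan h g →
      ∃ x : X, ‖x‖ ≤ 1 ∧ ∃ᶠ n in atTop, δ < |J (h n) x|
  · obtain ⟨g, hg, δ, hδ, H⟩ := H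
    obtain ⟨u, hu, hu2⟩ := exists_square_summable_functionals f hf hg H
    refine ⟨u, δ, hδ, fun j => ?_, fun x => ?_⟩
    · obtain ⟨x, hx, hux⟩ := hu j
      have := (u j).le_opNorm_of_le hx
      rw [Real.norm_eq_abs, mul_one] at this
      exact hux.trans ((le_abs_self _).trans this)
    · have h1 : Summable fun j => (u j x) ^ 2 :=
        summable_of_sum_range_le (fun _ => sq_nonneg _) (hu2 x)
      have h2 := h1.tendsto_atTop_zero.sqrt
      simp only [Real.sqrt_sq_eq_abs, Real.sqrt_zero] at h2
      exact tendsto_zero_iff_abs_tendsto_zero _ |>.2 h2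
  · push Not at H
    have h0 : IsBlockSeq fun k => Finsupp.single k (1 : ℝ) :=
      ⟨fun k => by simp [absSum_single], fun i j hij => by
        simpa [Finsupp.support_single] using hij⟩
    obtain ⟨s, -, hs⟩ := exists_seq_of_step (fun _ w => IsBlockSeq w) (fun k a b =>
      IsTailSpan b a ∧ ∀ x : X, ‖x‖ ≤ 1 → ∀ᶠ n in atTop, |J (b n) x| ≤ 1 / ((k : ℝ) + 1)) _ h0
      (fun k a ha => by
        obtain ⟨h, h1, h2, h3⟩ := H a ha (1 / ((k : ℝ) + 1)) (by positivity)
        exact ⟨h, h1, h2, h3⟩)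
    have hspan : ∀ j k, j ≤ k → IsTailSpan (s k) (s j) := by
      intro j k hjk
      induction k, hjk using Nat.le_induction with
      | base => exact IsTailSpan.refl _
      | succ k _ ih => exact (hs k).2.1.trans ih
    have hball : ∀ x : X, ‖x‖ ≤ 1 → Tendsto (fun n => J (s n n) x) atTop (𝓝 0) := by
      intro x hx
      rw [Metric.tendsto_atTop]
      intro ε hε
      obtain ⟨j, hj⟩ := exists_nat_one_div_lt hε
      obtain ⟨N, hN⟩ := eventually_atTop.1 ((hs j).2.2 x hx)
      -- From here on the diagonal block lies in the span of the tail of generation `j + 1` on which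
      -- evaluation at `x` is at most 1/(j+1).
      refine ⟨max N (j + 1), fun n hn => ?_⟩
      have h1 := (hs (j + 1)).1.abs_le_of_mem_span
        ((ContinuousLinearMap.apply ℝ ℝ x).toLinearMap ∘ₗ J) hN
        ((hspan (j + 1) n (le_of_max_le_right hn)).mem (le_of_max_le_left hn))
      rw [(hs n).1.absSum_eq, mul_one] at h1
      rw [Real.dist_0_eq_abs]
      exact lt_of_le_of_lt h1 hj
    refine ⟨fun n => J (s n n), c, hc, fun n => ?_, fun x => ?_⟩
    · simpa [(hs n).1.absSum_eq] using hfc (s n n)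
    · rcases eq_or_ne x 0 with rfl | hx
      · simp
      · have h1 := (hball (‖x‖⁻¹ • x) (by simp [norm_smul, hx])).const_mul ‖x‖
        have : ‖x‖ ≠ 0 := norm_ne_zero_iff.2 hx
        simpa [← mul_assoc, this] using h1

end Dual

/-- By Hahn–Banach, evaluation embeds X into the algebraic dual of X*. -/
theorem not_finiteDimensional_strongDual {𝕜 X : Type*} [RCLike 𝕜] [NormedAddCommGroup X]
    [NormedSpace 𝕜 X] (hX : ¬ FiniteDimensional 𝕜 X) :
    ¬ FiniteDimensional 𝕜 (StrongDual 𝕜 X) := by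
  intro h
  let f : X →ₗ[𝕜] Module.Dual 𝕜 (StrongDual 𝕜 X) :=
    { toFun := fun x =>
        { toFun := fun g => g x, map_add' := fun _ _ => rfl, map_smul' := fun _ _ => rfl }
      map_add' := fun x y => by ext; simp
      map_smul' := fun x y => by ext; simp }
  have hinj : Function.Injective f := by
    rw [injective_iff_map_eq_zero]
    intro x hx
    by_contra h0
    obtain ⟨g, -, hg⟩ := exists_dual_vector 𝕜 x (norm_ne_zero_iff.2 h0)
    have : g x = 0 := LinearMap.congr_fun hx g
    rw [this] at hg
    exact h0 (by simpa using hg.symm)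
  exact hX (FiniteDimensional.of_injective f hinj)

/-- The **Josefson–Nissenzweig theorem** for real spaces. -/
theorem exists_weakStar_null_real {X : Type*} [NormedAddCommGroup X] [NormedSpace ℝ X]
    (hX : ¬ FiniteDimensional ℝ X) :
    ∃ (u : ℕ → StrongDual ℝ X) (c : ℝ), 0 < c ∧ (∀ n, c ≤ ‖u n‖) ∧
      ∀ x, Tendsto (fun n => u n x) atTop (𝓝 0) := by
  obtain ⟨R, f, hR, hfR, hsep⟩ :=
    exists_seq_norm_le_one_le_norm_sub (not_finiteDimensional_strongDual hX)
  rcases exists_pointwise_tendsto_or_independent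
    (fun n (x : Metric.closedBall (0 : X) 1) => f n x) R (fun n x => by
      have := (f n).le_opNorm_of_le (mem_closedBall_zero_iff.1 x.2)
      rw [mul_one] at this
      exact this.trans (hfR n)) with ⟨φ, hφ, h⟩ | ⟨r, s, hrs, φ, hφ, h⟩
  · refine ⟨fun n => f (φ (n + 1)) - f (φ n), 1, one_pos,
      fun n => hsep (hφ (Nat.lt_succ_self n)).ne', fun x => ?_⟩
    obtain ⟨l, hl⟩ : ∃ l, Tendsto (fun k => f (φ k) x) atTop (𝓝 l) := by
      rcases eq_or_ne x 0 with rfl | hx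
      · exact ⟨0, by simp⟩
      · obtain ⟨l, hl⟩ := h ⟨‖x‖⁻¹ • x, by simp [norm_smul, hx]⟩
        have : ‖x‖ ≠ 0 := norm_ne_zero_iff.2 hx
        exact ⟨‖x‖ * l, by simpa [← mul_assoc, this] using hl.const_mul ‖x‖⟩
    simpa using ((tendsto_add_atTop_iff_nat 1).2 hl).sub hl
  · have hR0 : 0 < R := by linarith
    refine exists_weakStar_null_of_absSum_le (fun n => R⁻¹ • f (φ n)) (fun n => ?_)
      (c := (R⁻¹ * s - R⁻¹ * r) / 2) (by
        have := mul_lt_mul_of_pos_left hrs (inv_pos.2 hR0); linarith)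
      (absSum_le_norm_of_independent _ fun ε k => ?_)
    · rw [norm_smul, norm_inv, Real.norm_of_nonneg hR0.le, inv_mul_le_iff₀ hR0, mul_one]
      exact hfR _
    · obtain ⟨x, hx⟩ := h ε k
      refine ⟨x, mem_closedBall_zero_iff.1 x.2, fun i hi => ⟨fun hε => ?_, fun hε => ?_⟩⟩
      · exact mul_lt_mul_of_pos_left ((hx i hi).1 hε) (inv_pos.2 hR0)
      · exact mul_lt_mul_of_pos_left ((hx i hi).2 hε) (inv_pos.2 hR0)

/-- The **Josefson–Nissenzweig theorem**: the dual of an infinite-dimensional Banach space contains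
a bounded weak* null sequence which is bounded below in norm. -/
theorem exists_weakStar_null {𝕜 X : Type*} [RCLike 𝕜] [NormedAddCommGroup X] [NormedSpace 𝕜 X]
    [CompleteSpace X] (hX : ¬ FiniteDimensional 𝕜 X) :
    ∃ (u : ℕ → StrongDual 𝕜 X) (c C : ℝ), 0 < c ∧ (∀ n, c ≤ ‖u n‖) ∧ (∀ n, ‖u n‖ ≤ C) ∧
      ∀ x, Tendsto (fun n => u n x) atTop (𝓝 0) := by
  let _ : NormedSpace ℝ X := NormedSpace.restrictScalars ℝ 𝕜 X
  have : IsScalarTower ℝ 𝕜 X := ⟨fun a b x => by rw [Algebra.smul_def, mul_smul]; rfl⟩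
  have hXr : ¬ FiniteDimensional ℝ X := fun h => hX (FiniteDimensional.right ℝ 𝕜 X)
  obtain ⟨v, c, hc, hv, hv0⟩ := exists_weakStar_null_real hXr
  -- The extension x ↦ v(x) − i v(ix) stays weak* null, and its real part is v, so its norm is no
  -- smaller. Completeness of X then gives boundedness by Banach–Steinhaus.
  have hu0 : ∀ x, Tendsto (fun n => (v n).extendRCLike (𝕜 := 𝕜) x) atTop (𝓝 0) := by
    intro x
    simp only [StrongDual.extendRCLike_apply]
    have h1 := (RCLike.continuous_ofReal (K := 𝕜)).tendsto 0 |>.comp (hv0 x)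
    have h2 := (RCLike.continuous_ofReal (K := 𝕜)).tendsto 0 |>.comp (hv0 ((RCLike.I : 𝕜) • x))
    simpa [Function.comp_def] using h1.sub (h2.const_mul (RCLike.I : 𝕜))
  obtain ⟨C, hC⟩ := banach_steinhaus (g := fun n => (v n).extendRCLike (𝕜 := 𝕜)) fun x => by
    obtain ⟨C, hC⟩ := (hu0 x).norm.bddAbove_range
    exact ⟨C, fun n => hC ⟨n, rfl⟩⟩
  refine ⟨fun n => (v n).extendRCLike (𝕜 := 𝕜), c, C, hc, fun n => (hv n).trans ?_, hC, hu0⟩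
  refine ContinuousLinearMap.opNorm_le_bound _ (norm_nonneg _) fun x => ?_
  have h1 := ContinuousLinearMap.le_opNorm ((v n).extendRCLike (𝕜 := 𝕜)) x
  rw [← StrongDual.re_extendRCLike_apply (𝕜 := 𝕜) (v n) x, Real.norm_eq_abs]
  exact (RCLike.abs_re_le_norm _).trans h1

/-! ### Rosenthal's lemma and operators on ℓ^∞ -/

/-- **Rosenthal's lemma** for uniformly bounded superadditive set functions. -/
theorem exists_strictMono_le_of_superadditive (ν : ℕ → Set ℕ → ℝ) (h0 : ∀ k S, 0 ≤ ν k S)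
    (hadd : ∀ k S T V, Disjoint S T → S ⊆ V → T ⊆ V → ν k S + ν k T ≤ ν k V)
    {C : ℝ} (hC : ∀ k S, ν k S ≤ C) {ε : ℝ} (hε : 0 < ε) :
    ∃ φ : ℕ → ℕ, StrictMono φ ∧ ∀ k, ν (φ k) (Set.range φ \ {φ k}) ≤ ε := by
  have hmono : ∀ k S T, S ⊆ T → ν k S ≤ ν k T := fun k S T hST => by
    have := hadd k S ∅ T (Set.disjoint_empty _) hST (Set.empty_subset _)
    linarith [h0 k ∅]
  -- Induction on the total mass in units of `ε`. The range is split into infinitely many rows by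
  -- `Nat.pair`. If every row fails, one bad point is taken from each; these points miss the rest of
  -- each chosen row, which carries mass above `ε`, so superadditivity lowers `m` by one.
  have main : ∀ m : ℕ, ∀ φ : ℕ → ℕ, StrictMono φ → (∀ k, ν (φ k) (Set.range φ) ≤ m * ε) →
      ∃ φ : ℕ → ℕ, StrictMono φ ∧ ∀ k, ν (φ k) (Set.range φ \ {φ k}) ≤ ε := by
    intro m
    induction m with
    | zero =>
      intro φ hφ h
      refine ⟨φ, hφ, fun k => (hmono _ _ _ Set.sdiff_subset).trans ((h k).trans ?_)⟩
      simpa using hε.le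
    | succ m ih =>
      intro φ hφ h
      have hpair : ∀ p, StrictMono fun i => φ (Nat.pair p i) := fun p i j hij =>
        hφ (Nat.pair_lt_pair_right p hij)
      by_contra! hno
      choose i hi using fun p => hno _ (hpair p)
      obtain ⟨θ, hθ, hθ2⟩ := strictMono_subseq_of_id_le (u := fun p => Nat.pair p (i p))
        fun p => Nat.left_le_pair p (i p)
      obtain ⟨ψ, hψ, hψ2⟩ := ih _ (hφ.comp hθ2) (fun q => by
        have h1 := h (Nat.pair (θ q) (i (θ q)))
        have h2 := hi (θ q)
        have h3 := hadd (φ (Nat.pair (θ q) (i (θ q))))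
          (Set.range (φ ∘ (fun p => Nat.pair p (i p)) ∘ θ))
          (Set.range (fun j => φ (Nat.pair (θ q) j)) \ {φ (Nat.pair (θ q) (i (θ q)))})
          (Set.range φ) (by
            rw [Set.disjoint_left]
            rintro _ ⟨a, rfl⟩ ⟨⟨j, hj⟩, hne⟩
            have h4 : Nat.pair (θ q) j = Nat.pair (θ a) (i (θ a)) := hφ.injective hj
            have h5 := (Nat.pair_eq_pair.1 h4).1
            exact hne (by simp [h5])) (by rintro _ ⟨a, rfl⟩; exact ⟨_, rfl⟩)
          (by rintro _ ⟨⟨j, rfl⟩, -⟩; exact ⟨_, rfl⟩)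
        push_cast at h1
        simp only [Function.comp_apply] at h3 ⊢
        linarith)
      obtain ⟨k, hk⟩ := hno ψ hψ
      exact (hψ2 k).not_gt hk
  obtain ⟨m, hm⟩ := exists_nat_ge (C / ε)
  exact main m id strictMono_id fun k => (hC _ _).trans ((div_le_iff₀ hε).1 hm)

section

variable {𝕜 : Type*} [RCLike 𝕜]

theorem ContainsIsomorphically.of_bounds {F E : Type*} [NormedAddCommGroup F] [NormedSpace 𝕜 F]
    [NormedAddCommGroup E] [NormedSpace 𝕜 E] (f : E →L[𝕜] F) {c : ℝ} (hc : 0 < c)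
    (hf : ∀ x, c * ‖x‖ ≤ ‖f x‖) : ContainsIsomorphically 𝕜 F E := by
  have hinj : Function.Injective f.toLinearMap := by
    rw [injective_iff_map_eq_zero]
    intro x hx
    have h1 := hf x
    have h2 : f x = 0 := hx
    rw [h2, norm_zero] at h1
    exact norm_le_zero_iff.1 (nonpos_of_mul_nonpos_right h1 hc)
  refine ⟨f.toLinearMap.range,
    ⟨(LinearEquiv.ofInjective f.toLinearMap hinj).toContinuousLinearEquivOfBounds ‖f‖ c⁻¹
      (fun x => f.le_opNorm x) fun y => ?_⟩⟩
  obtain ⟨x, rfl⟩ := (LinearEquiv.ofInjective f.toLinearMap hinj).surjective y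
  rw [LinearEquiv.symm_apply_apply, ← div_eq_inv_mul, le_div_iff₀ hc, mul_comm]
  exact hf x

theorem ContainsIsomorphically.exists_bounded_below {F E : Type*} [NormedAddCommGroup F]
    [NormedSpace 𝕜 F] [NormedAddCommGroup E] [NormedSpace 𝕜 E]
    (h : ContainsIsomorphically 𝕜 F E) :
    ∃ (f : E →L[𝕜] F) (c : ℝ), 0 < c ∧ ∀ x, c * ‖x‖ ≤ ‖f x‖ := by
  obtain ⟨S, ⟨e⟩⟩ := h
  refine ⟨S.subtypeL ∘L (e : E →L[𝕜] S), (‖(e.symm : S →L[𝕜] E)‖ + 1)⁻¹, by positivity,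
    fun x => ?_⟩
  have h1 := (e.symm : S →L[𝕜] E).le_opNorm (e x)
  have h2 : ‖(S.subtypeL ∘L (e : E →L[𝕜] S)) x‖ = ‖e x‖ := rfl
  rw [ContinuousLinearEquiv.coe_coe, e.symm_apply_apply] at h1
  rw [h2, inv_mul_le_iff₀ (by positivity)]
  nlinarith [norm_nonneg (e x)]

/-- The variation on `S` of a functional on `ℓ^∞`. -/
noncomputable def variationOn (μ : StrongDual 𝕜 (LInfty 𝕜)) (S : Set ℕ) : ℝ :=
  sSup ((fun ξ => ‖μ ξ‖) '' {ξ | ‖ξ‖ ≤ 1 ∧ ∀ i ∉ S, ξ i = 0})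

theorem le_variationOn (μ : StrongDual 𝕜 (LInfty 𝕜)) {S : Set ℕ} {ξ : LInfty 𝕜} (h1 : ‖ξ‖ ≤ 1)
    (hS : ∀ i ∉ S, ξ i = 0) : ‖μ ξ‖ ≤ variationOn μ S := by
  refine le_csSup ⟨‖μ‖, ?_⟩ ⟨ξ, ⟨h1, hS⟩, rfl⟩
  rintro _ ⟨η, ⟨hη, -⟩, rfl⟩
  simpa using μ.le_opNorm_of_le hη

theorem variationOn_le (μ : StrongDual 𝕜 (LInfty 𝕜)) {S : Set ℕ} {C : ℝ}
    (h : ∀ ξ : LInfty 𝕜, ‖ξ‖ ≤ 1 → (∀ i ∉ S, ξ i = 0) → ‖μ ξ‖ ≤ C) : variationOn μ S ≤ C := by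
  refine csSup_le ⟨_, 0, ⟨by simp, fun _ _ => rfl⟩, rfl⟩ ?_
  rintro _ ⟨ξ, ⟨h1, h2⟩, rfl⟩
  exact h ξ h1 h2

theorem variationOn_nonneg (μ : StrongDual 𝕜 (LInfty 𝕜)) (S : Set ℕ) : 0 ≤ variationOn μ S := by
  simpa using le_variationOn μ (S := S) (ξ := 0) (by simp) fun _ _ => rfl

theorem norm_le_variationOn_mul (μ : StrongDual 𝕜 (LInfty 𝕜)) {S : Set ℕ} {ξ : LInfty 𝕜}
    (hS : ∀ i ∉ S, ξ i = 0) : ‖μ ξ‖ ≤ variationOn μ S * ‖ξ‖ := by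
  rcases eq_or_ne ξ 0 with rfl | hξ
  · simp
  have hξ' : 0 < ‖ξ‖ := norm_pos_iff.2 hξ
  have h := le_variationOn μ (S := S) (ξ := ((‖ξ‖⁻¹ : ℝ) : 𝕜) • ξ)
    (by rw [norm_smul]; simp [hξ'.ne'])
    (fun i hi => by rw [lp.coeFn_smul, Pi.smul_apply, hS i hi, smul_zero])
  rw [map_smul, norm_smul, RCLike.norm_ofReal, abs_of_pos (inv_pos.2 hξ'), inv_mul_le_iff₀ hξ'] at h
  rwa [mul_comm]

/-- Unimodular factors make both values of `μ` nonnegative, and disjointly supported vectors of the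
unit ball add up to a vector of the unit ball. -/
theorem variationOn_add_le (μ : StrongDual 𝕜 (LInfty 𝕜)) {S T V : Set ℕ} (hST : Disjoint S T)
    (hS : S ⊆ V) (hT : T ⊆ V) : variationOn μ S + variationOn μ T ≤ variationOn μ V := by
  rw [← le_sub_iff_add_le]
  refine variationOn_le μ fun ξ hξ hξS => ?_
  rw [le_sub_comm]
  refine variationOn_le μ fun η hη hηT => ?_
  rw [le_sub_iff_add_le]
  obtain ⟨a, ha, ha'⟩ := RCLike.exists_norm_eq_mul_self (μ ξ)
  obtain ⟨b, hb, hb'⟩ := RCLike.exists_norm_eq_mul_self (μ η)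
  have h := le_variationOn μ (S := V) (ξ := a • ξ + b • η)
    (lp.norm_le_of_forall_le zero_le_one fun i => by
      rw [lp.coeFn_add, Pi.add_apply, lp.coeFn_smul, lp.coeFn_smul, Pi.smul_apply, Pi.smul_apply]
      by_cases hi : i ∈ S
      · rw [hηT i (Set.disjoint_left.1 hST hi), smul_zero, add_zero, norm_smul, ha, one_mul]
        exact (lp.norm_apply_le_norm (by simp) ξ i).trans hξ
      · rw [hξS i hi, smul_zero, zero_add, norm_smul, hb, one_mul]
        exact (lp.norm_apply_le_norm (by simp) η i).trans hη)
    (fun i hi => by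
      rw [lp.coeFn_add, Pi.add_apply, lp.coeFn_smul, lp.coeFn_smul, Pi.smul_apply, Pi.smul_apply,
        hξS i fun h => hi (hS h), hηT i fun h => hi (hT h), smul_zero, smul_zero, add_zero])
  rw [map_add, map_smul, map_smul, smul_eq_mul, smul_eq_mul, ← ha', ← hb', ← RCLike.ofReal_add,
    RCLike.norm_ofReal, abs_of_nonneg (by positivity)] at h
  linarith

/-- Extension by zero along an injective map of indices. -/
noncomputable def LInfty.extend (φ : ℕ → ℕ) (hφ : Function.Injective φ) :
    LInfty 𝕜 →L[𝕜] LInfty 𝕜 :=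
  LinearMap.mkContinuous
    { toFun := fun a => ⟨Function.extend φ a 0, memℓp_infty ⟨‖a‖, by
        rintro _ ⟨i, rfl⟩
        by_cases hi : ∃ j, φ j = i
        · obtain ⟨j, rfl⟩ := hi
          simpa [hφ.extend_apply] using lp.norm_apply_le_norm (by simp) a j
        · simp [Function.extend_apply' _ _ _ hi]⟩⟩
      map_add' := fun a b => by
        ext i
        change Function.extend φ (fun j => a j + b j) 0 i =
          Function.extend φ a 0 i + Function.extend φ b 0 i
        by_cases hi : ∃ j, φ j = i
        · obtain ⟨j, rfl⟩ := hi
          simp [hφ.extend_apply]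
        · simp [Function.extend_apply' _ _ _ hi]
      map_smul' := fun c a => by
        ext i
        change Function.extend φ (fun j => c * a j) 0 i = c * Function.extend φ a 0 i
        by_cases hi : ∃ j, φ j = i
        · obtain ⟨j, rfl⟩ := hi
          simp [hφ.extend_apply]
        · simp [Function.extend_apply' _ _ _ hi] } 1 fun a => by
    rw [one_mul]
    refine lp.norm_le_of_forall_le (norm_nonneg a) fun i => ?_
    by_cases hi : ∃ j, φ j = i
    · obtain ⟨j, rfl⟩ := hi
      simpa [hφ.extend_apply] using lp.norm_apply_le_norm (by simp) a j
    · simp [Function.extend_apply' _ _ _ hi]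

theorem LInfty.extend_apply {φ : ℕ → ℕ} (hφ : Function.Injective φ) (a : LInfty 𝕜) (j : ℕ) :
    LInfty.extend (𝕜 := 𝕜) φ hφ a (φ j) = a j :=
  hφ.extend_apply _ _ _

theorem LInfty.extend_apply_of_notMem {φ : ℕ → ℕ} (hφ : Function.Injective φ) (a : LInfty 𝕜)
    {i : ℕ} (hi : i ∉ Set.range φ) : LInfty.extend (𝕜 := 𝕜) φ hφ a i = 0 :=
  Function.extend_apply' _ _ _ hi

/-- **Rosenthal's theorem**: an operator on `ℓ^∞` which is bounded below on the unit vectors fixes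
a copy of `ℓ^∞`. -/
theorem containsIsomorphically_LInfty_of_le_norm_single {Z : Type*} [NormedAddCommGroup Z]
    [NormedSpace 𝕜 Z] (Φ : LInfty 𝕜 →L[𝕜] Z) {δ : ℝ} (hδ : 0 < δ)
    (h : ∀ n, δ ≤ ‖Φ (lp.single ∞ n (1 : 𝕜))‖) : ContainsIsomorphically 𝕜 Z (LInfty 𝕜) := by
  choose g hg hgn using fun n => exists_dual_vector'' 𝕜 (Φ (lp.single ∞ n (1 : 𝕜)))
  have hμ : ∀ n ξ, ‖(g n ∘L Φ) ξ‖ ≤ ‖Φ ξ‖ := fun n ξ => by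
    simpa using (g n).le_of_opNorm_le (hg n) (Φ ξ)
  obtain ⟨φ, hφ, hφ2⟩ := exists_strictMono_le_of_superadditive
    (fun n => variationOn (g n ∘L Φ)) (fun n => variationOn_nonneg _)
    (fun n _ _ _ => variationOn_add_le _) (C := ‖Φ‖)
    (fun n S => variationOn_le _ fun ξ hξ _ =>
      (hμ n ξ).trans (by simpa using Φ.le_opNorm_of_le hξ)) (half_pos hδ)
  have hlow : ∀ ξ : LInfty 𝕜, (∀ i ∉ Set.range φ, ξ i = 0) → δ / 2 * ‖ξ‖ ≤ ‖Φ ξ‖ := by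
    intro ξ hξ
    -- Write ξ = ξ_n e_n + η. The functional norming Φ e_n is at most (δ/2)‖ξ‖ on η, so δ|ξ_n| ≤ ‖Φ
    -- ξ‖ + (δ/2)‖ξ‖; the supremum over coordinates absorbs the last term.
    have hcoord : ∀ i, ‖ξ i‖ ≤ (‖Φ ξ‖ + δ / 2 * ‖ξ‖) / δ := by
      intro i
      by_cases hi : i ∈ Set.range φ
      swap
      · rw [hξ i hi, norm_zero]; positivity
      obtain ⟨k, rfl⟩ := hi
      set n := φ k
      set η : LInfty 𝕜 := ξ - ξ n • lp.single ∞ n (1 : 𝕜) with hη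
      have hηc : ∀ i, η i = ξ i - ξ n * (lp.single ∞ n (1 : 𝕜) : LInfty 𝕜) i := fun _ => rfl
      have hηn : η n = 0 := by simp [hηc]
      have hηi : ∀ i, i ≠ n → η i = ξ i := fun i hi => by simp [hηc, hi]
      have hηξ : ‖η‖ ≤ ‖ξ‖ := lp.norm_le_of_forall_le (norm_nonneg _) fun i => by
        by_cases hi : i = n
        · rw [hi, hηn, norm_zero]; exact norm_nonneg _
        · rw [hηi i hi]; exact lp.norm_apply_le_norm (by simp) ξ i
      have h1 : ‖(g n ∘L Φ) η‖ ≤ δ / 2 * ‖ξ‖ :=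
        (norm_le_variationOn_mul _ (S := Set.range φ \ {n}) fun i hi => by
          by_cases hin : i = n
          · rw [hin, hηn]
          · rw [hηi i hin]; exact hξ i fun h => hi ⟨h, hin⟩).trans
        (mul_le_mul (hφ2 k) hηξ (norm_nonneg _) (half_pos hδ).le)
      have h2 : (g n ∘L Φ) ξ = (g n ∘L Φ) η + ξ n * ‖Φ (lp.single ∞ n (1 : 𝕜))‖ := by
        rw [hη, map_sub, map_smul]
        simp [hgn]
      have h3 : ‖ξ n‖ * δ ≤ ‖ξ n * (‖Φ (lp.single ∞ n (1 : 𝕜))‖ : 𝕜)‖ := by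
        rw [norm_mul, RCLike.norm_ofReal, abs_norm]
        exact mul_le_mul_of_nonneg_left (h n) (norm_nonneg _)
      have h4 : ‖ξ n * (‖Φ (lp.single ∞ n (1 : 𝕜))‖ : 𝕜)‖ ≤
          ‖(g n ∘L Φ) ξ‖ + ‖(g n ∘L Φ) η‖ := by
        rw [eq_sub_of_add_eq' h2.symm]; exact norm_sub_le _ _
      rw [le_div_iff₀ hδ]
      linarith [hμ n ξ]
    have h5 := lp.norm_le_of_forall_le (by positivity) hcoord
    rw [le_div_iff₀ hδ] at h5
    linarith
  refine ContainsIsomorphically.of_bounds (Φ ∘L LInfty.extend φ hφ.injective) (half_pos hδ)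
    fun a => ?_
  refine le_trans ?_ (hlow _ fun i => LInfty.extend_apply_of_notMem hφ.injective a)
  refine mul_le_mul_of_nonneg_left ?_ (half_pos hδ).le
  refine lp.norm_le_of_forall_le (norm_nonneg _) fun j => ?_
  rw [← LInfty.extend_apply hφ.injective a j]
  exact lp.norm_apply_le_norm (by simp) _ _

end

/-! ### Unconditionally Cauchy series of operators -/

section

variable {𝕜 : Type*} [RCLike 𝕜] {X : Type*} [NormedAddCommGroup X] [NormedSpace 𝕜 X]
  {Y : Type*} [NormedAddCommGroup Y] [NormedSpace 𝕜 Y]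

/-- A sequence of operators which is bounded below in norm and whose bounded multiples are
unconditionally summable in the strong operator topology spans a copy of `ℓ^∞`. -/
theorem containsIsomorphically_LInfty_of_summable (T : ℕ → X →L[𝕜] Y) {δ C : ℝ} (hδ : 0 < δ)
    (hT : ∀ n, δ ≤ ‖T n‖)
    (hC : ∀ (F : Finset ℕ) (a : ℕ → 𝕜) (B : ℝ), 0 ≤ B → (∀ i, ‖a i‖ ≤ B) → ∀ x,
      ‖∑ i ∈ F, a i • T i x‖ ≤ C * B * ‖x‖)
    (hs : ∀ (ξ : LInfty 𝕜) x, Summable fun n => ξ n • T n x) :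
    ContainsIsomorphically 𝕜 (X →L[𝕜] Y) (LInfty 𝕜) := by
  let Φ : LInfty 𝕜 →L[𝕜] X →L[𝕜] Y := LinearMap.mkContinuous₂
    (LinearMap.mk₂ 𝕜 (fun ξ x => ∑' n, (ξ : LInfty 𝕜) n • T n x)
      (fun ξ η x => by
        rw [← (hs ξ x).tsum_add (hs η x)]
        simp only [lp.coeFn_add, Pi.add_apply, add_smul])
      (fun c ξ x => by
        rw [← (hs ξ x).tsum_const_smul c]
        simp only [lp.coeFn_smul, Pi.smul_apply, smul_assoc])
      (fun ξ x y => by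
        rw [← (hs ξ x).tsum_add (hs ξ y)]
        simp only [map_add, smul_add])
      (fun c ξ x => by
        rw [← (hs ξ x).tsum_const_smul c]
        simp only [map_smul, smul_comm c])) C fun ξ x => by
    refine le_of_tendsto (hs ξ x).hasSum.norm (Eventually.of_forall fun F => ?_)
    exact hC F ξ ‖ξ‖ (norm_nonneg _) (fun i => lp.norm_apply_le_norm (by simp) ξ i) x
  refine containsIsomorphically_LInfty_of_le_norm_single Φ hδ fun n => (hT n).trans_eq ?_
  congr 1
  ext x
  have : Φ (lp.single ∞ n (1 : 𝕜)) x = ∑' i, (lp.single ∞ n (1 : 𝕜) : LInfty 𝕜) i • T i x := rfl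
  rw [this, tsum_eq_single n fun i hi => by simp [hi]]
  simp

/-- A weakly unconditionally Cauchy series which does not converge has blocks which are bounded
below in norm and again form a weakly unconditionally Cauchy series. -/
theorem exists_blocks_of_not_summable [CompleteSpace Y] (y : ℕ → Y) {C : ℝ}
    (hC : ∀ (F : Finset ℕ) (a : ℕ → 𝕜) (B : ℝ), 0 ≤ B → (∀ i, ‖a i‖ ≤ B) →
      ‖∑ i ∈ F, a i • y i‖ ≤ C * B) (hy : ¬ Summable y) :
    ∃ (z : ℕ → Y) (ε : ℝ), 0 < ε ∧ (∀ n, ε ≤ ‖z n‖) ∧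
      ∀ (F : Finset ℕ) (a : ℕ → 𝕜) (B : ℝ), 0 ≤ B → (∀ i, ‖a i‖ ≤ B) →
        ‖∑ i ∈ F, a i • z i‖ ≤ C * B := by
  classical
  rw [summable_iff_vanishing_norm] at hy
  push Not at hy
  obtain ⟨ε, hε, h⟩ := hy
  choose t ht htε using h
  -- Each new block, given by the failed Cauchy criterion, avoids all indices used before.
  let s : ℕ → Finset ℕ := fun k => Nat.rec ∅ (fun _ s => s ∪ t s) k
  have hs : ∀ k, s (k + 1) = s k ∪ t (s k) := fun _ => rfl
  have hmono : Monotone s := monotone_nat_of_le_succ fun k => by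
    rw [hs]; exact Finset.subset_union_left
  have hlt : ∀ i j, i < j → Disjoint (t (s i)) (t (s j)) := fun i j hij => by
    refine Disjoint.mono_left ?_ (ht (s j)).symm
    exact (hs i ▸ Finset.subset_union_right : t (s i) ⊆ s (i + 1)).trans (hmono hij)
  have hdisj : ∀ i j, i ≠ j → Disjoint (t (s i)) (t (s j)) := fun i j hij =>
    (lt_or_gt_of_ne hij).elim (hlt i j) fun h => (hlt j i h).symm
  refine ⟨fun k => ∑ i ∈ t (s k), y i, ε, hε, fun k => htε _, fun F a B hB ha => ?_⟩
  -- Coefficients constant on each block and zero elsewhere turn block sums into sums of the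
  -- original series, so `C` is inherited.
  let b : ℕ → 𝕜 := fun i => if h : ∃ k, i ∈ t (s k) then a h.choose else 0
  have hb : ∀ k, ∀ i ∈ t (s k), b i = a k := fun k i hi => by
    have h : ∃ k, i ∈ t (s k) := ⟨k, hi⟩
    have hk : h.choose = k := by
      by_contra hne
      exact Finset.disjoint_left.1 (hdisj _ _ hne) h.choose_spec hi
    simp only [b, dif_pos h, hk]
  have hsum : ∑ k ∈ F, a k • ∑ i ∈ t (s k), y i = ∑ i ∈ F.biUnion fun k => t (s k), b i • y i := by
    rw [Finset.sum_biUnion fun i _ j _ hij => hdisj i j hij]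
    refine Finset.sum_congr rfl fun k _ => ?_
    rw [Finset.smul_sum]
    exact Finset.sum_congr rfl fun i hi => by rw [hb k i hi]
  rw [hsum]
  refine hC _ b B hB fun i => ?_
  simp only [b]
  split_ifs
  · exact ha _
  · simpa using hB

/-- If `Y` contains a weakly unconditionally Cauchy series whose terms are bounded below and `X` is
infinite-dimensional, then the space of operators contains `ℓ^∞`. -/
theorem containsIsomorphically_LInfty_of_blocks [CompleteSpace X] [CompleteSpace Y]
    (hX : ¬ FiniteDimensional 𝕜 X) (z : ℕ → Y) {ε C : ℝ} (hε : 0 < ε) (hz : ∀ n, ε ≤ ‖z n‖)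
    (hC0 : 0 ≤ C)
    (hC : ∀ (F : Finset ℕ) (a : ℕ → 𝕜) (B : ℝ), 0 ≤ B → (∀ i, ‖a i‖ ≤ B) →
      ‖∑ i ∈ F, a i • z i‖ ≤ C * B) :
    ContainsIsomorphically 𝕜 (X →L[𝕜] Y) (LInfty 𝕜) := by
  obtain ⟨u, c, K, hc, huc, huK, hu⟩ := exists_weakStar_null hX
  have hK : 0 ≤ K := (norm_nonneg _).trans (huK 0)
  refine containsIsomorphically_LInfty_of_summable (fun n => (u n).smulRight (z n))
    (mul_pos hc hε) (C := C * K) (fun n => ?_) (fun F a B hB ha x => ?_) fun ξ x => ?_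
  · rw [ContinuousLinearMap.norm_smulRight_apply]
    exact mul_le_mul (huc n) (hz n) hε.le (norm_nonneg _)
  · have h := hC F (fun i => a i * u i x) (B * (K * ‖x‖)) (by positivity) fun i => by
      rw [norm_mul]
      exact mul_le_mul (ha i) ((u i).le_of_opNorm_le (huK i) x) (norm_nonneg _) hB
    simp only [ContinuousLinearMap.smulRight_apply, ← mul_smul]
    refine h.trans_eq (by ring)
  · simp only [ContinuousLinearMap.smulRight_apply, ← mul_smul]
    have hlim : Tendsto (fun n => ‖u n x‖ * ‖ξ‖) atTop (𝓝 0) := by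
      simpa using (hu x).norm.mul_const ‖ξ‖
    rw [summable_iff_vanishing_norm]
    intro η hη
    obtain ⟨N, hN⟩ := eventually_atTop.1 (hlim.eventually_le_const
      (show 0 < η / (C + 1) by positivity))
    refine ⟨Finset.range N, fun t ht => ?_⟩
    -- Zeroing the coefficients below `N` makes the bound uniform over all indices, as `hC`
    -- requires; the denominator C + 1 yields a strict inequality even when C = 0.
    have h := hC t (fun i => if i < N then 0 else ξ i * u i x) (η / (C + 1)) (by positivity)
      fun i => by
        split_ifs with hi
        · rw [norm_zero]; positivity
        · refine le_trans ?_ (hN i (not_lt.1 hi))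
          rw [norm_mul, mul_comm]
          exact mul_le_mul_of_nonneg_left (lp.norm_apply_le_norm (by simp) ξ i) (norm_nonneg _)
    have heq : ∑ i ∈ t, (ξ i * u i x) • z i =
        ∑ i ∈ t, (if i < N then 0 else ξ i * u i x) • z i :=
      Finset.sum_congr rfl fun i hi => by
        rw [if_neg fun h => Finset.disjoint_left.1 ht hi (Finset.mem_range.2 h)]
    rw [heq]
    refine h.trans_lt ?_
    rw [← mul_div_assoc, div_lt_iff₀ (by positivity)]
    linarith

/-- If `X` is infinite-dimensional and the space of operators contains a weakly unconditionally
Cauchy series whose terms are bounded below, then it contains `ℓ^∞`. -/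
theorem containsIsomorphically_LInfty_of_weaklyUnconditionallyCauchy [CompleteSpace X]
    [CompleteSpace Y] (hX : ¬ FiniteDimensional 𝕜 X) (T : ℕ → X →L[𝕜] Y) {δ C : ℝ} (hδ : 0 < δ)
    (hT : ∀ n, δ ≤ ‖T n‖) (hC0 : 0 ≤ C)
    (hC : ∀ (F : Finset ℕ) (a : ℕ → 𝕜) (B : ℝ), 0 ≤ B → (∀ i, ‖a i‖ ≤ B) →
      ‖∑ i ∈ F, a i • T i‖ ≤ C * B) :
    ContainsIsomorphically 𝕜 (X →L[𝕜] Y) (LInfty 𝕜) := by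
  have hCx : ∀ (F : Finset ℕ) (a : ℕ → 𝕜) (B : ℝ), 0 ≤ B → (∀ i, ‖a i‖ ≤ B) → ∀ x,
      ‖∑ i ∈ F, a i • T i x‖ ≤ C * B * ‖x‖ := fun F a B hB ha x => by
    simpa using (∑ i ∈ F, a i • T i).le_of_opNorm_le (hC F a B hB ha) x
  -- Either the operators already sum strongly, or a divergent series in Y supplies blocks to pair
  -- with a weak* null sequence.
  by_cases hs : ∀ (ξ : LInfty 𝕜) x, Summable fun n => ξ n • T n x
  · exact containsIsomorphically_LInfty_of_summable T hδ hT hCx hs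
  · push Not at hs
    obtain ⟨ξ, x, hs⟩ := hs
    obtain ⟨z, ε, hε, hz, hzC⟩ := exists_blocks_of_not_summable (𝕜 := 𝕜) _
      (C := C * (‖ξ‖ * ‖x‖)) (fun F a B hB ha => by
        have h := hCx F (fun i => a i * ξ i) (B * ‖ξ‖) (by positivity) (fun i => by
          rw [norm_mul]
          exact mul_le_mul (ha i) (lp.norm_apply_le_norm (by simp) ξ i) (norm_nonneg _) hB) x
        simp only [← mul_smul]
        exact h.trans_eq (by ring)) hs
    exact containsIsomorphically_LInfty_of_blocks hX z hε hz (by positivity) hzC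

/-! ### Unit vectors of c₀ and the conclusion -/

/-- The unit vectors of `c₀`. -/
noncomputable def CZero.single (𝕜 : Type*) [RCLike 𝕜] (n : ℕ) : CZero 𝕜 where
  toFun := Pi.single n 1
  continuous_toFun := continuous_of_discreteTopology
  zero_at_infty' := by
    rw [cocompact_eq_cofinite]
    refine tendsto_const_nhds.congr' ?_
    filter_upwards [(Set.finite_singleton n).compl_mem_cofinite] with i hi
    exact (Pi.single_eq_of_ne (M := fun _ => 𝕜) hi 1).symm

theorem CZero.norm_le {g : CZero 𝕜} {B : ℝ} (hB : 0 ≤ B) : ‖g‖ ≤ B ↔ ∀ i, ‖g i‖ ≤ B := by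
  rw [← ZeroAtInftyContinuousMap.norm_toBCF_eq_norm, BoundedContinuousFunction.norm_le hB]
  rfl

/-- At each coordinate at most one summand survives. An operator carries this bound to the wuC
estimate for the images of the unit vectors. -/
theorem CZero.norm_sum_single_le (F : Finset ℕ) (a : ℕ → 𝕜) {B : ℝ} (hB : 0 ≤ B)
    (ha : ∀ i, ‖a i‖ ≤ B) : ‖∑ i ∈ F, a i • CZero.single 𝕜 i‖ ≤ B := by
  refine (CZero.norm_le hB).2 fun j => ?_
  let ev : CZero 𝕜 →+ 𝕜 := ⟨⟨fun g => g j, rfl⟩, fun _ _ => rfl⟩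
  have h : (∑ i ∈ F, a i • CZero.single 𝕜 i : CZero 𝕜) j =
      ∑ i ∈ F, a i • (Pi.single i 1 : ℕ → 𝕜) j := map_sum ev _ _
  rw [h]
  by_cases hj : j ∈ F
  · rw [Finset.sum_eq_single j (fun i _ hi => by simp [Pi.single_eq_of_ne hi.symm])
      fun h => absurd hj h]
    simpa using ha j
  · rw [Finset.sum_eq_zero fun i hi => by
      rw [Pi.single_eq_of_ne (by rintro rfl; exact hj hi), smul_zero], norm_zero]
    exact hB

theorem CZero.one_le_norm_single (n : ℕ) : 1 ≤ ‖CZero.single 𝕜 n‖ := by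
  have h := (CZero.norm_le (norm_nonneg (CZero.single 𝕜 n))).1 le_rfl n
  have h1 : CZero.single 𝕜 n n = 1 := Pi.single_eq_same n 1
  rwa [h1, norm_one] at h

end

theorem proposition6 {𝕜 : Type*} [RCLike 𝕜]
    {X : Type*} [NormedAddCommGroup X] [NormedSpace 𝕜 X] [CompleteSpace X]
    {Y : Type*} [NormedAddCommGroup Y] [NormedSpace 𝕜 Y] [CompleteSpace Y]
    (hX : ¬ FiniteDimensional 𝕜 X) (hY : ¬ FiniteDimensional 𝕜 Y)
    (h : ¬ ContainsIsomorphically 𝕜 (X →L[𝕜] Y) (LInfty 𝕜)) :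
    ¬ ContainsIsomorphically 𝕜 (CompactOps 𝕜 X Y) (CZero 𝕜) := by
  intro hK
  obtain ⟨f, c, hc, hf⟩ := hK.exists_bounded_below
  -- The copy of c₀ is viewed inside the full operator space, where the wuC argument takes place.
  let L : CZero 𝕜 →L[𝕜] X →L[𝕜] Y := (CompactOps 𝕜 X Y).subtypeL ∘L f
  have hL : ∀ g, c * ‖g‖ ≤ ‖L g‖ := hf
  refine h (containsIsomorphically_LInfty_of_weaklyUnconditionallyCauchy hX
    (fun n => L (CZero.single 𝕜 n)) hc (fun n => ?_) (norm_nonneg L) fun F a B hB ha => ?_)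
  · exact (le_mul_of_one_le_right hc.le (CZero.one_le_norm_single n)).trans (hL _)
  · simp only [← map_smul, ← map_sum]
    exact L.le_opNorm_of_le (CZero.norm_sum_single_le F a hB ha)
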